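/- Let $\Theta$ be a compact subset of $\{(p,a_1,a_2)\in(0,1)^3 : a_1<a_2\}\subset\mathbb R^3$. For $\theta=(p,a_1,a_2)\in\Theta$ let $\nu_\theta=p\,\delta_{a_1}+(1-p)\,\delta_{a_2}$, let $\omega=(\omega_x)_{x\in\mathbb Z}$ be i.i.d. with law $\nu_\theta$ under $\mathbb P^\theta=\nu_\theta^{\otimes\mathbb Z}$, with expectation $\mathbb E^\theta$, and let $\rho_0=(1-\omega_0)/\omega_0$. Suppose that for every $\theta\in\Theta$ $$\mathbb E^\theta|\log\rho_0|<\infty,\qquad \mathbb E^\theta(\log\rho_0)<0,\qquad \mathbb E^\theta(\rho_0)<1,\qquad \mathbb E^\theta(\rho_0^3)<1 .$$ For $x,y\in\mathbb Z_+$ and $\theta\in(0,1)\times\{(a_1,a_2)\in(0,1)^2:a_1<a_2\}$, define $\nu_\theta$ by the same formula and put $$\phi_\theta(x,y)=\log\int_0^1 a^{x+1}(1-a)^y\,d\nu_\theta(a),\qquad Q_\theta(x,y)=\binom{x+y}{x}e^{\phi_\theta(x,y)} .$$ Denote by $\dot{}$ and $\ddot{}$ the gradient and the Hessian in $\theta$,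 and by $\|\cdot\|$ the uniform norm (the largest modulus of an entry). Then for every $\theta\in\Theta$ the kernel $Q_\theta$ on $\mathbb Z_+$ has exactly one stationary probability distribution $\pi_\theta$; and, writing $\tilde\pi_\theta(g)=\sum_{x,y\ge0}\pi_\theta(x)Q_\theta(x,y)g(x,y)$, the following hold. 1. (Differentiability) For all $x,y\in\mathbb Z_+$, the map $\theta\mapsto\phi_\theta(x,y)$ is twice continuously differentiable on (a neighbourhood of each point of) $\Theta$. 2. (Regularity) For every $\theta\in\Theta$ there is $q>1$ such that $\tilde\pi_\theta(\|\dot\phi_\theta\|^{2q})<\infty$; and for every $\theta\in\Theta$ and $x\in\mathbb Z_+$, $$\sum_{y\ge0}\dot Q_\theta(x,y)=\partial_\theta\sum_{y\ge0}Q_\theta(x,y)=0 .$$ 3. (Uniform conditions) Every $\theta\in\Theta$ has a neighbourhood $\mathcal V(\theta)$, on which all the maps $\theta'\mapsto\phi_{\theta'}(x,y)$ are twice continuously differentiable, such that $$\tilde\pi_\theta\Big(\sup_{\theta'\in\mathcal V(\theta)}\|\dot\phi_{\theta'}\|^2\Big)<\infty\quad\text{and}\quad \tilde\pi_\theta\Big(\sup_{\theta'\in\mathcal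 V(\theta)}\|\ddot\phi_{\theta'}\|\Big)<\infty .$$ -/

import Mathlib

open MeasureTheory Topology
open scoped ENNReal

noncomputable section

namespace RWRE

/-- A parametric family of laws `ν θ` on `(0,1)` (regarded as measures on `ℝ`), with parameter
`θ ∈ ℝ^d`. The space `Fin d → ℝ` carries the uniform norm. -/
abbrev Model (d : ℕ) := (Fin d → ℝ) → Measure ℝ

/-- The law `ν_θ^{⊗ℤ}` of the i.i.d. environment `ω = (ω_x)_{x ∈ ℤ}`. -/
def envLaw {d : ℕ} (ν : Model d) (θ : Fin d → ℝ) : Measure (ℤ → ℝ) :=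
  Measure.infinitePi (fun _ : ℤ => ν θ)

/-- The ratio `ρ_x = (1 - ω_x) / ω_x`. -/
def rho (x : ℤ) (ω : ℤ → ℝ) : ℝ := (1 - ω x) / ω x

/-- Transience to the right: for every `θ ∈ Θ`, `log ρ_0` is integrable and has negative mean. -/
def TransientRight {d : ℕ} (ν : Model d) (Θ : Set (Fin d → ℝ)) : Prop :=
  ∀ θ ∈ Θ, Integrable (fun ω => Real.log (rho 0 ω)) (envLaw ν θ) ∧
    ∫ ω, Real.log (rho 0 ω) ∂(envLaw ν θ) < 0

/-- Ballistic case: for every `θ ∈ Θ`, `E^θ[ρ_0] < 1`. -/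
def Ballistic {d : ℕ} (ν : Model d) (Θ : Set (Fin d → ℝ)) : Prop :=
  ∀ θ ∈ Θ, Integrable (rho 0) (envLaw ν θ) ∧ ∫ ω, rho 0 ω ∂(envLaw ν θ) < 1

/-- `φ_θ(x,y) = log ∫_0^1 a^{x+1} (1-a)^y dν_θ(a)`. -/
def phi {d : ℕ} (ν : Model d) (x y : ℕ) (θ : Fin d → ℝ) : ℝ :=
  Real.log (∫ a in Set.Ioo (0 : ℝ) 1, a ^ (x + 1) * (1 - a) ^ y ∂(ν θ))

/-- The transition kernel `Q_θ(x,y) = binom(x+y, x) exp(φ_θ(x,y))` on the nonnegative integers. -/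
def Q {d : ℕ} (ν : Model d) (x y : ℕ) (θ : Fin d → ℝ) : ℝ :=
  ((x + y).choose x : ℝ) * Real.exp (phi ν x y θ)

/-- `π` is a stationary probability distribution of `Q_θ`. -/
structure IsStationaryLaw {d : ℕ} (ν : Model d) (θ : Fin d → ℝ) (π : ℕ → ℝ) : Prop where
  nonneg : ∀ x, 0 ≤ π x
  sum_eq_one : HasSum π 1
  stationary : ∀ y, HasSum (fun x => π x * Q ν x y θ) (π y)

/-- `π̃_θ(g) = ∑_{x,y} π(x) Q_θ(x,y) g(x,y)` for a nonnegative, possibly infinite `g`. -/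
def piTilde {d : ℕ} (ν : Model d) (θ : Fin d → ℝ) (π : ℕ → ℝ) (g : ℕ → ℕ → ℝ≥0∞) : ℝ≥0∞ :=
  ∑' z : ℕ × ℕ, ENNReal.ofReal (π z.1 * Q ν z.1 z.2 θ) * g z.1 z.2

/-- The gradient of `f` at `θ`, as the vector of its partial derivatives. -/
def grad {d : ℕ} (f : (Fin d → ℝ) → ℝ) (θ : Fin d → ℝ) : Fin d → ℝ :=
  fun i => fderiv ℝ f θ (Pi.single i 1)

/-- The Hessian matrix of `f` at `θ`; its norm is the largest modulus of an entry. -/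
def hess {d : ℕ} (f : (Fin d → ℝ) → ℝ) (θ : Fin d → ℝ) : Fin d → Fin d → ℝ :=
  fun i j => grad (fun θ' => grad f θ' j) θ i

/-- Differentiability: every `θ ↦ φ_θ(x,y)` is twice continuously differentiable on `Θ`, i.e. it
is of class `C²` in a neighbourhood of each point of `Θ`. -/
def Differentiability {d : ℕ} (ν : Model d) (Θ : Set (Fin d → ℝ)) : Prop :=
  ∀ x y : ℕ, ∀ θ ∈ Θ, ContDiffAt ℝ 2 (phi ν x y) θ

/-- Regularity conditions. The second one says that, for every `θ ∈ Θ` and `x`,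
`∑_y ∂_θ Q_θ(x,y) = ∂_θ ∑_y Q_θ(x,y) = 0`, where all derivatives exist and all series converge. -/
def Regularity {d : ℕ} (ν : Model d) (Θ : Set (Fin d → ℝ)) : Prop :=
  (∀ θ ∈ Θ, ∀ π : ℕ → ℝ, IsStationaryLaw ν θ π →
    ∃ q : ℝ, 1 < q ∧ piTilde ν θ π (fun x y => ‖grad (phi ν x y) θ‖ₑ ^ (2 * q)) < ∞) ∧
  (∀ θ ∈ Θ, ∀ x : ℕ,
    (∀ y, DifferentiableAt ℝ (Q ν x y) θ) ∧
    HasSum (fun y => grad (Q ν x y) θ) 0 ∧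
    (∀ᶠ θ' in 𝓝 θ, Summable (fun y => Q ν x y θ')) ∧
    DifferentiableAt ℝ (fun θ' => ∑' y, Q ν x y θ') θ ∧
    grad (fun θ' => ∑' y, Q ν x y θ') θ = 0)

/-- Uniform conditions: every `θ ∈ Θ` has a neighbourhood `V`, on which all the functions
`φ_θ(x,y)` are of class `C²`, with `π̃_θ(sup_V ‖grad φ‖²) < ∞` and `π̃_θ(sup_V ‖hess φ‖) < ∞`. -/
def UniformConditions {d : ℕ} (ν : Model d) (Θ : Set (Fin d → ℝ)) : Prop :=
  ∀ θ ∈ Θ, ∀ π : ℕ → ℝ, IsStationaryLaw ν θ π →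
    ∃ V : Set (Fin d → ℝ), IsOpen V ∧ θ ∈ V ∧ (∀ x y, ContDiffOn ℝ 2 (phi ν x y) V) ∧
      piTilde ν θ π (fun x y => ⨆ θ' ∈ V, ‖grad (phi ν x y) θ'‖ₑ ^ 2) < ∞ ∧
      piTilde ν θ π (fun x y => ⨆ θ' ∈ V, ‖hess (phi ν x y) θ'‖ₑ) < ∞

/-- The two-point model `ν_θ = p δ_{a₁} + (1-p) δ_{a₂}` with `θ = (p, a₁, a₂)`. -/
def twoPoint : Model 3 := fun θ =>
  ENNReal.ofReal (θ 0) • Measure.dirac (θ 1) + ENNReal.ofReal (1 - θ 0) • Measure.dirac (θ 2)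

/-- The set `(0,1) × {(a₁,a₂) ∈ (0,1)² : a₁ < a₂}`. -/
def twoPointDomain : Set (Fin 3 → ℝ) :=
  {θ | θ 0 ∈ Set.Ioo (0 : ℝ) 1 ∧ θ 1 ∈ Set.Ioo (0 : ℝ) 1 ∧ θ 2 ∈ Set.Ioo (0 : ℝ) 1 ∧ θ 1 < θ 2}

end RWRE

end

namespace RWRE

/-- The law of the number of failures before the `(x+1)`-st success in Bernoulli trials with success
probability `a`. -/
def negBin (a : ℝ) (x y : ℕ) : ℝ := ((x + y).choose x : ℝ) * (a ^ (x + 1) * (1 - a) ^ y)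

lemma negBin_nonneg {a : ℝ} (ha : a ∈ Set.Ioo (0 : ℝ) 1) (x y : ℕ) : 0 ≤ negBin a x y := by
  have h1 := ha.1.le
  have h2 : 0 ≤ 1 - a := by linarith [ha.2]
  unfold negBin
  positivity

lemma hasSum_negBin_mul_choose {a : ℝ} (ha : a ∈ Set.Ioo (0 : ℝ) 1) (x j : ℕ) :
    HasSum (fun y => negBin a x y * (y.choose j : ℝ))
      (((x + j).choose j : ℝ) * ((1 - a) / a) ^ j) := by
  have ha0 := ha.1
  have ha1 : 0 < 1 - a := by linarith [ha.2]
  have hn : ‖1 - a‖ < 1 := by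
    rw [Real.norm_eq_abs, abs_of_pos ha1]; linarith
  have h := (hasSum_choose_mul_geometric_of_norm_lt_one (x + j) hn).mul_left
    (((x + j).choose j : ℝ) * (a ^ (x + 1) * (1 - a) ^ j))
  have hsum : ∑ i ∈ Finset.range j, negBin a x i * (i.choose j : ℝ) = 0 :=
    Finset.sum_eq_zero fun i hi => by
      rw [Nat.choose_eq_zero_of_lt (Finset.mem_range.1 hi)]; simp
  have hkey := (hasSum_nat_add_iff (f := fun y => negBin a x y * (y.choose j : ℝ))
    (g := ((x + j).choose j : ℝ) * ((1 - a) / a) ^ j) j).1 ?_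
  · rwa [hsum, add_zero] at hkey
  · have hval : ((x + j).choose j : ℝ) * ((1 - a) / a) ^ j = ((x + j).choose j : ℝ) *
        (a ^ (x + 1) * (1 - a) ^ j) * (1 / (1 - (1 - a)) ^ (x + j + 1)) := by
      rw [sub_sub_cancel, div_pow, show x + j + 1 = (x + 1) + j by ring, pow_add a (x + 1) j]
      field_simp
    rw [hval]
    have hfun : (fun y => negBin a x (y + j) * ((y + j).choose j : ℝ)) = fun y =>
        ((x + j).choose j : ℝ) * (a ^ (x + 1) * (1 - a) ^ j) *
          (((y + (x + j)).choose (x + j) : ℝ) * (1 - a) ^ y) := by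
      funext y
      have hc : (x + (y + j)).choose x * (y + j).choose j
          = (x + j).choose j * (y + (x + j)).choose (x + j) := by
        have e1 := Nat.choose_mul (n := x + (y + j)) (k := y + j) (s := j) (by omega)
        have e2 := Nat.choose_mul (n := x + (y + j)) (k := x + j) (s := j) (by omega)
        have e3 : (x + (y + j)).choose (y + j) = (x + (y + j)).choose x := by
          rw [Nat.choose_symm_add]
        have e4 : (x + (y + j) - j).choose (y + j - j) = (x + (y + j) - j).choose (x + j - j) := by
          have : x + (y + j) - j = x + y := by omega
          rw [this, Nat.add_sub_cancel, Nat.add_sub_cancel, Nat.choose_symm_add]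
        rw [e3, e4, ← e2] at e1
        rw [e1, show y + (x + j) = x + (y + j) by omega, mul_comm]
      have hc' : ((x + (y + j)).choose x : ℝ) * (y + j).choose j
          = (x + j).choose j * (y + (x + j)).choose (x + j) := by exact_mod_cast hc
      simp only [negBin]
      rw [pow_add (1 - a) y j]
      linear_combination (a ^ (x + 1) * ((1 - a) ^ y * (1 - a) ^ j)) * hc'
    rw [hfun]
    exact h

lemma hasSum_negBin {a : ℝ} (ha : a ∈ Set.Ioo (0 : ℝ) 1) (x : ℕ) : HasSum (negBin a x) 1 := by
  simpa using hasSum_negBin_mul_choose ha x 0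

lemma hasSum_negBin_mul {a : ℝ} (ha : a ∈ Set.Ioo (0 : ℝ) 1) (x : ℕ) :
    HasSum (fun y => negBin a x y * (y : ℝ)) ((x + 1) * ((1 - a) / a)) := by
  simpa using hasSum_negBin_mul_choose ha x 1

lemma negBin_succ_zero (a : ℝ) (x : ℕ) : negBin a (x + 1) 0 = a * negBin a x 0 := by
  simp [negBin]; ring

lemma negBin_succ_succ (a : ℝ) (x y : ℕ) :
    negBin a (x + 1) (y + 1) = a * negBin a x (y + 1) + (1 - a) * negBin a (x + 1) y := by
  have h : ((x + 1 + (y + 1)).choose (x + 1) : ℝ)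
      = (x + (y + 1)).choose x + (x + 1 + y).choose (x + 1) := by
    have e : x + 1 + (y + 1) = (x + (y + 1)) + 1 := by omega
    rw [e, Nat.choose_succ_succ, show x + 1 + y = x + (y + 1) by omega]
    push_cast; ring
  simp only [negBin, h]
  ring

lemma summable_mul_of_bounded {p f : ℕ → ℝ} {C : ℝ} (hp : Summable p) (hp0 : ∀ y, 0 ≤ p y)
    (hf : ∀ y, |f y| ≤ C) : Summable fun y => p y * f y :=
  Summable.of_norm_bounded (hp.mul_right C) fun y => by
    rw [norm_mul, Real.norm_eq_abs, Real.norm_eq_abs, abs_of_nonneg (hp0 y)]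
    exact mul_le_mul_of_nonneg_left (hf y) (hp0 y)

lemma abs_tsum_mul_le {p f : ℕ → ℝ} {C s : ℝ} (hp : HasSum p s) (hp0 : ∀ y, 0 ≤ p y)
    (hf : ∀ y, |f y| ≤ C) : |∑' y, p y * f y| ≤ s * C := by
  have h := tsum_of_norm_bounded (f := fun y => p y * f y) (hp.mul_right C) fun y => by
    rw [norm_mul, Real.norm_eq_abs, Real.norm_eq_abs, abs_of_nonneg (hp0 y)]
    exact mul_le_mul_of_nonneg_left (hf y) (hp0 y)
  simpa using h

/-- The mean of a function with increments at most `c` under the negative binomial law has increments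
at most `c (1 - a) / a` in the number of successes. -/
lemma abs_tsum_negBin_succ_sub_le {a : ℝ} (ha : a ∈ Set.Ioo (0 : ℝ) 1) {f : ℕ → ℝ} {C c : ℝ}
    (hC : ∀ y, |f y| ≤ C) (hc : ∀ y, |f (y + 1) - f y| ≤ c) (x : ℕ) :
    |∑' y, negBin a (x + 1) y * f y - ∑' y, negBin a x y * f y| ≤ (1 - a) / a * c := by
  have ha0 := ha.1
  have ha1 : 0 < 1 - a := by linarith [ha.2]
  have S : ∀ x (g : ℕ → ℝ), (∀ y, |g y| ≤ C) → Summable fun y => negBin a x y * g y :=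
    fun x g hg => summable_mul_of_bounded (hasSum_negBin ha x).summable (negBin_nonneg ha x) hg
  have s1 := S (x + 1) f hC
  have s0 := S x f hC
  have s1' := S (x + 1) (fun y => f (y + 1)) fun y => hC _
  have s0' := (summable_nat_add_iff 1).2 s0
  have e : ∑' y, negBin a (x + 1) y * f y
      = a * ∑' y, negBin a x y * f y + (1 - a) * ∑' y, negBin a (x + 1) y * f (y + 1) := by
    rw [s1.tsum_eq_zero_add, s0.tsum_eq_zero_add, mul_add, ← tsum_mul_left, ← tsum_mul_left,
      negBin_succ_zero, add_assoc, ← (s0'.mul_left a).tsum_add (s1'.mul_left (1 - a))]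
    congr 1
    · ring
    · exact tsum_congr fun y => by rw [negBin_succ_succ]; ring
  have e2 : ∑' y, negBin a (x + 1) y * (f (y + 1) - f y)
      = ∑' y, negBin a (x + 1) y * f (y + 1) - ∑' y, negBin a (x + 1) y * f y := by
    rw [← s1'.tsum_sub s1]
    exact tsum_congr fun y => by ring
  have h := abs_tsum_mul_le (hasSum_negBin ha (x + 1)) (negBin_nonneg ha _) hc
  rw [one_mul] at h
  have e3 : ∑' y, negBin a (x + 1) y * f y - ∑' y, negBin a x y * f y
      = (1 - a) / a * ∑' y, negBin a (x + 1) y * (f (y + 1) - f y) := by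
    rw [e2]; field_simp; linear_combination e
  rw [e3, abs_mul, abs_of_pos (div_pos ha1 ha0)]
  exact mul_le_mul_of_nonneg_left h (div_pos ha1 ha0).le

open BoundedContinuousFunction Filter

/-- A Markov kernel on `ℕ` that contracts increments by the factor `r < 1`. -/
structure IsContractingKernel (K : ℕ → ℕ → ℝ) (r : ℝ) : Prop where
  nonneg : ∀ x y, 0 ≤ K x y
  hasSum_one : ∀ x, HasSum (K x) 1
  hasSum_mean : ∀ x : ℕ, HasSum (fun y => K x y * (y : ℝ)) (r * (x + 1))
  rate_nonneg : 0 ≤ r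
  rate_lt_one : r < 1
  contract : ∀ (f : ℕ →ᵇ ℝ) (c : ℝ), (∀ x, |f (x + 1) - f x| ≤ c) →
    ∀ x, |∑' y, K (x + 1) y * f y - ∑' y, K x y * f y| ≤ r * c

namespace IsContractingKernel

variable {K : ℕ → ℕ → ℝ} {r : ℝ}

lemma summable (hK : IsContractingKernel K r) (f : ℕ →ᵇ ℝ) (x : ℕ) :
    Summable fun y => K x y * f y :=
  summable_mul_of_bounded (hK.hasSum_one x).summable (hK.nonneg x) (C := ‖f‖)
    fun y => f.norm_coe_le_norm y

/-- The action of the kernel on bounded functions. -/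
noncomputable def op (hK : IsContractingKernel K r) : (ℕ →ᵇ ℝ) →ₗ[ℝ] (ℕ →ᵇ ℝ) where
  toFun f := BoundedContinuousFunction.ofNormedAddCommGroupDiscrete
    (fun x => ∑' y, K x y * f y) ‖f‖ fun x => by
      simpa using abs_tsum_mul_le (hK.hasSum_one x) (hK.nonneg x) (C := ‖f‖)
        fun y => f.norm_coe_le_norm y
  map_add' f g := by
    ext x
    simp only [coe_ofNormedAddCommGroupDiscrete, coe_add, Pi.add_apply]
    rw [← (hK.summable f x).tsum_add (hK.summable g x)]
    exact tsum_congr fun y => by ring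
  map_smul' c f := by
    ext x
    simp only [coe_ofNormedAddCommGroupDiscrete, coe_smul, RingHom.id_apply, smul_eq_mul]
    rw [← tsum_mul_left]
    exact tsum_congr fun y => by ring

lemma op_apply (hK : IsContractingKernel K r) (f : ℕ →ᵇ ℝ) (x : ℕ) :
    hK.op f x = ∑' y, K x y * f y := rfl

lemma abs_op_pow_apply_le (hK : IsContractingKernel K r) (f : ℕ →ᵇ ℝ) (n x : ℕ) :
    |(hK.op ^ n) f x| ≤ ‖f‖ := by
  induction n generalizing x with
  | zero => exact f.norm_coe_le_norm x
  | succ n ih =>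
    rw [pow_succ', Module.End.mul_apply, op_apply]
    simpa using abs_tsum_mul_le (hK.hasSum_one x) (hK.nonneg x) ih

lemma op_pow_nonneg (hK : IsContractingKernel K r) {f : ℕ →ᵇ ℝ} (hf : ∀ x, 0 ≤ f x) (n x : ℕ) :
    0 ≤ (hK.op ^ n) f x := by
  induction n generalizing x with
  | zero => exact hf x
  | succ n ih =>
    rw [pow_succ', Module.End.mul_apply, op_apply]
    exact tsum_nonneg fun y => mul_nonneg (hK.nonneg x y) (ih y)

lemma abs_op_pow_succ_sub_le (hK : IsContractingKernel K r) (f : ℕ →ᵇ ℝ) (n x : ℕ) :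
    |(hK.op ^ n) f (x + 1) - (hK.op ^ n) f x| ≤ r ^ n * (2 * ‖f‖) := by
  induction n generalizing x with
  | zero =>
    have h1 := f.norm_coe_le_norm (x + 1)
    have h2 := f.norm_coe_le_norm x
    rw [Real.norm_eq_abs] at h1 h2
    simpa [two_mul] using (abs_sub _ _).trans (add_le_add h1 h2)
  | succ n ih =>
    rw [pow_succ', Module.End.mul_apply, op_apply, op_apply, pow_succ', mul_assoc]
    exact hK.contract _ _ ih x

lemma abs_op_pow_sub_zero_le (hK : IsContractingKernel K r) (f : ℕ →ᵇ ℝ) (n x : ℕ) :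
    |(hK.op ^ n) f x - (hK.op ^ n) f 0| ≤ r ^ n * (2 * ‖f‖) * x := by
  induction x with
  | zero => simp
  | succ x ih =>
    have h := abs_op_pow_succ_sub_le hK f n x
    have := abs_sub_le ((hK.op ^ n) f (x + 1)) ((hK.op ^ n) f x) ((hK.op ^ n) f 0)
    push_cast
    linarith

lemma abs_op_pow_succ_zero_sub_le (hK : IsContractingKernel K r) (f : ℕ →ᵇ ℝ) (n : ℕ) :
    |(hK.op ^ n) f 0 - (hK.op ^ (n + 1)) f 0| ≤ (2 * ‖f‖ * r) * r ^ n := by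
  have e : (hK.op ^ (n + 1)) f 0 - (hK.op ^ n) f 0
      = ∑' y, K 0 y * ((hK.op ^ n) f y - (hK.op ^ n) f 0) := by
    have h1 := hK.summable ((hK.op ^ n) f) 0
    have h2 := (hK.hasSum_one 0).mul_right ((hK.op ^ n) f 0)
    rw [one_mul] at h2
    rw [pow_succ', Module.End.mul_apply, op_apply]
    conv_lhs => rw [← h2.tsum_eq]
    rw [← h1.tsum_sub h2.summable]
    exact tsum_congr fun y => by ring
  have hm := (hK.hasSum_mean 0).mul_right (r ^ n * (2 * ‖f‖))
  have h := tsum_of_norm_bounded (f := fun y => K 0 y * ((hK.op ^ n) f y - (hK.op ^ n) f 0)) hm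
    fun y => by
      rw [norm_mul, Real.norm_eq_abs, Real.norm_eq_abs, abs_of_nonneg (hK.nonneg 0 y), mul_assoc]
      refine mul_le_mul_of_nonneg_left ?_ (hK.nonneg 0 y)
      rw [mul_comm (y : ℝ)]
      exact abs_op_pow_sub_zero_le hK f n y
  rw [abs_sub_comm, e]
  rw [Real.norm_eq_abs] at h
  refine h.trans (le_of_eq ?_)
  push_cast; ring

lemma exists_tendsto_op_pow (hK : IsContractingKernel K r) (f : ℕ →ᵇ ℝ) :
    ∃ l : ℝ, Tendsto (fun n => (hK.op ^ n) f 0) atTop (𝓝 l) :=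
  cauchySeq_tendsto_of_complete <|
    cauchySeq_of_le_geometric r (2 * ‖f‖ * r) hK.rate_lt_one fun n => by
      rw [Real.dist_eq]; exact abs_op_pow_succ_zero_sub_le hK f n

/-- The limit of the means of `f` under the iterates of the kernel. -/
noncomputable def limMean (hK : IsContractingKernel K r) (f : ℕ →ᵇ ℝ) : ℝ :=
  (hK.exists_tendsto_op_pow f).choose

lemma tendsto_limMean (hK : IsContractingKernel K r) (f : ℕ →ᵇ ℝ) (x : ℕ) :
    Tendsto (fun n => (hK.op ^ n) f x) atTop (𝓝 (hK.limMean f)) := by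
  have h0 : Tendsto (fun n => (hK.op ^ n) f 0) atTop (𝓝 (hK.limMean f)) :=
    (hK.exists_tendsto_op_pow f).choose_spec
  have h1 : Tendsto (fun n => (hK.op ^ n) f x - (hK.op ^ n) f 0) atTop (𝓝 0) := by
    refine squeeze_zero_norm (a := fun n => r ^ n * (2 * ‖f‖) * x)
      (fun n => abs_op_pow_sub_zero_le hK f n x) ?_
    simpa using ((tendsto_pow_atTop_nhds_zero_of_lt_one hK.rate_nonneg hK.rate_lt_one).mul_const
      (2 * ‖f‖)).mul_const (x : ℝ)
  simpa using h1.add h0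

lemma limMean_add (hK : IsContractingKernel K r) (f g : ℕ →ᵇ ℝ) :
    hK.limMean (f + g) = hK.limMean f + hK.limMean g := by
  refine tendsto_nhds_unique (hK.tendsto_limMean (f + g) 0) ?_
  simpa using (hK.tendsto_limMean f 0).add (hK.tendsto_limMean g 0)

lemma limMean_smul (hK : IsContractingKernel K r) (c : ℝ) (f : ℕ →ᵇ ℝ) :
    hK.limMean (c • f) = c * hK.limMean f := by
  refine tendsto_nhds_unique (hK.tendsto_limMean (c • f) 0) ?_
  simpa using (hK.tendsto_limMean f 0).const_mul c

lemma limMean_op (hK : IsContractingKernel K r) (f : ℕ →ᵇ ℝ) :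
    hK.limMean (hK.op f) = hK.limMean f := by
  refine tendsto_nhds_unique (hK.tendsto_limMean (hK.op f) 0) ?_
  have := (tendsto_add_atTop_iff_nat 1).2 (hK.tendsto_limMean f 0)
  simpa only [pow_succ, Module.End.mul_apply] using this

lemma limMean_nonneg (hK : IsContractingKernel K r) {f : ℕ →ᵇ ℝ} (hf : ∀ x, 0 ≤ f x) :
    0 ≤ hK.limMean f :=
  ge_of_tendsto' (hK.tendsto_limMean f 0) fun n => hK.op_pow_nonneg hf n 0

lemma limMean_const_one (hK : IsContractingKernel K r) :
    hK.limMean (BoundedContinuousFunction.const ℕ 1) = 1 := by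
  have h : hK.op (BoundedContinuousFunction.const ℕ 1) = BoundedContinuousFunction.const ℕ 1 := by
    ext x
    simpa [op_apply] using (hK.hasSum_one x).tsum_eq
  have h' : ∀ n : ℕ, (hK.op ^ n) (BoundedContinuousFunction.const ℕ 1)
      = BoundedContinuousFunction.const ℕ 1 := by
    intro n
    induction n with
    | zero => rfl
    | succ n ih => rw [pow_succ, Module.End.mul_apply, h, ih]
  refine tendsto_nhds_unique (hK.tendsto_limMean _ 0) ?_
  simp [h']

/-- Under a drift condition `K V ≤ s V + B` with `s < 1`, the limiting mean of a bounded function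
below `c V` is at most `c B / (1 - s)`. -/
lemma limMean_le_of_drift (hK : IsContractingKernel K r) {V W : ℕ → ℝ} {s B c : ℝ} (hs0 : 0 ≤ s)
    (hs1 : s < 1) (hc : 0 ≤ c)
    (hsum : ∀ x, HasSum (fun y => K x y * V y) (W x)) (hW : ∀ x, W x ≤ s * V x + B)
    {f : ℕ →ᵇ ℝ} (hf : ∀ x, f x ≤ c * V x) : hK.limMean f ≤ c * (B / (1 - s)) := by
  have key : ∀ n x, (hK.op ^ n) f x ≤ c * s ^ n * V x + c * (B / (1 - s)) * (1 - s ^ n) := by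
    intro n
    induction n with
    | zero => intro x; simpa using hf x
    | succ n ih =>
      intro x
      rw [pow_succ', Module.End.mul_apply, op_apply]
      have hb := ((hsum x).mul_left (c * s ^ n)).add
        ((hK.hasSum_one x).mul_left (c * (B / (1 - s)) * (1 - s ^ n)))
      have h1 := hasSum_le (fun y => ?_) (hK.summable ((hK.op ^ n) f) x).hasSum hb
      · refine h1.trans ?_
        have h2 : c * s ^ n * W x ≤ c * s ^ n * (s * V x + B) :=
          mul_le_mul_of_nonneg_left (hW x) (by positivity)
        have h3 : 1 - s ≠ 0 := by linarith
        have h4 : c * s ^ n * (s * V x + B) + c * (B / (1 - s)) * (1 - s ^ n) * 1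
            = c * s ^ (n + 1) * V x + c * (B / (1 - s)) * (1 - s ^ (n + 1)) := by
          field_simp
          ring
        linarith
      · have := mul_le_mul_of_nonneg_left (ih y) (hK.nonneg x y)
        refine this.trans (le_of_eq (by ring))
  have hlim : Tendsto (fun n => c * s ^ n * V 0 + c * (B / (1 - s)) * (1 - s ^ n)) atTop
      (𝓝 (c * (B / (1 - s)))) := by
    have h := tendsto_pow_atTop_nhds_zero_of_lt_one hs0 hs1
    simpa using ((h.const_mul c).mul_const (V 0)).add ((h.const_sub 1).const_mul (c * (B / (1 - s))))
  exact le_of_tendsto_of_tendsto' (hK.tendsto_limMean f 0) hlim fun n => key n 0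

lemma summable_prod (hK : IsContractingKernel K r) {p : ℕ → ℝ} (h0 : ∀ x, 0 ≤ p x)
    (h1 : Summable p) : Summable fun z : ℕ × ℕ => p z.1 * K z.1 z.2 := by
  have hp : 0 ≤ fun z : ℕ × ℕ => p z.1 * K z.1 z.2 :=
    fun z => mul_nonneg (h0 z.1) (hK.nonneg z.1 z.2)
  rw [summable_prod_of_nonneg hp]
  constructor
  · intro x
    exact (hK.hasSum_one x).summable.mul_left (p x)
  · have e : (fun x => ∑' y, p x * K x y) = p := by
      funext x
      rw [tsum_mul_left, (hK.hasSum_one x).tsum_eq, mul_one]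
    simpa only [e] using h1

/-- A stationary probability integrates bounded functions to their limiting mean. -/
lemma hasSum_of_stationary (hK : IsContractingKernel K r) {π : ℕ → ℝ} (h0 : ∀ x, 0 ≤ π x)
    (h1 : HasSum π 1) (hst : ∀ y, HasSum (fun x => π x * K x y) (π y)) (f : ℕ →ᵇ ℝ) :
    HasSum (fun x => π x * f x) (hK.limMean f) := by
  have S : ∀ g : ℕ →ᵇ ℝ, Summable fun x => π x * g x := fun g =>
    summable_mul_of_bounded h1.summable h0 (C := ‖g‖) fun y => g.norm_coe_le_norm y
  have inv : ∀ g : ℕ →ᵇ ℝ, ∑' x, π x * hK.op g x = ∑' x, π x * g x := by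
    intro g
    have hs := hK.summable_prod h0 h1.summable
    have hs' : Summable (Function.uncurry fun x y : ℕ => π x * K x y * g y) := by
      refine Summable.of_norm_bounded (hs.mul_right ‖g‖) fun z => ?_
      simp only [Function.uncurry, norm_mul]
      rw [Real.norm_of_nonneg (h0 _), Real.norm_of_nonneg (hK.nonneg _ _)]
      exact mul_le_mul_of_nonneg_left (g.norm_coe_le_norm _) (mul_nonneg (h0 _) (hK.nonneg _ _))
    calc ∑' x, π x * hK.op g x = ∑' x, ∑' y, π x * K x y * g y :=
          tsum_congr fun x => by
            rw [op_apply, ← tsum_mul_left]; exact tsum_congr fun y => by ring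
      _ = ∑' y, ∑' x, π x * K x y * g y := hs'.tsum_comm.symm
      _ = ∑' y, π y * g y := tsum_congr fun y => by rw [tsum_mul_right, (hst y).tsum_eq]
  have invn : ∀ n : ℕ, ∑' x, π x * (hK.op ^ n) f x = ∑' x, π x * f x := by
    intro n
    induction n with
    | zero => rfl
    | succ n ih => rw [pow_succ', ← ih]; exact inv _
  have lim : Tendsto (fun n => ∑' x, π x * (hK.op ^ n) f x) atTop
      (𝓝 (∑' x, π x * hK.limMean f)) := by
    refine tendsto_tsum_of_dominated_convergence (bound := fun x => π x * ‖f‖)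
      (h1.summable.mul_right _) (fun x => (hK.tendsto_limMean f x).const_mul _)
      (Eventually.of_forall fun n x => ?_)
    rw [norm_mul, Real.norm_of_nonneg (h0 x)]
    exact mul_le_mul_of_nonneg_left (hK.abs_op_pow_apply_le f n x) (h0 x)
  simp only [invn, tsum_mul_right, h1.tsum_eq, one_mul] at lim
  have := (S f).hasSum
  rwa [tendsto_nhds_unique tendsto_const_nhds lim] at this

/-- The restriction of a bounded function to a set. -/
noncomputable def restr (s : Set ℕ) (f : ℕ →ᵇ ℝ) : ℕ →ᵇ ℝ :=
  BoundedContinuousFunction.ofNormedAddCommGroupDiscrete (s.indicator f) ‖f‖ fun x =>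
    (norm_indicator_le_norm_self _ _).trans (f.norm_coe_le_norm x)

@[simp] lemma restr_apply (s : Set ℕ) (f : ℕ →ᵇ ℝ) (x : ℕ) : restr s f x = s.indicator f x := rfl

/-- The mass function of the stationary law. -/
noncomputable def limLaw (hK : IsContractingKernel K r) (k : ℕ) : ℝ :=
  hK.limMean (restr {k} (BoundedContinuousFunction.const ℕ 1))

lemma limLaw_nonneg (hK : IsContractingKernel K r) (k : ℕ) : 0 ≤ hK.limLaw k :=
  hK.limMean_nonneg fun x => by
    by_cases hx : x = k <;> simp [hx]

lemma sum_limLaw_mul (hK : IsContractingKernel K r) (f : ℕ →ᵇ ℝ) (N : ℕ) :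
    ∑ k ∈ Finset.range N, hK.limLaw k * f k = hK.limMean (restr {k | k < N} f) := by
  induction N with
  | zero =>
    have h : restr {k | k < 0} f = (0 : ℝ) • f := by ext x; simp
    rw [h, limMean_smul]; simp
  | succ N ih =>
    rw [Finset.sum_range_succ, ih, limLaw, mul_comm, ← limMean_smul, ← limMean_add]
    congr 1
    ext x
    simp only [coe_add, Pi.add_apply, restr_apply, coe_smul, Set.indicator, Set.mem_ofPred_eq,
      Set.mem_singleton_iff, smul_eq_mul, const_apply]
    rcases lt_trichotomy x N with h | h | h
    · rw [if_pos h, if_neg h.ne, if_pos (by omega)]; simp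
    · rw [if_neg (by omega), if_pos h, if_pos (by omega), h]; simp
    · rw [if_neg (by omega), if_neg h.ne', if_neg (by omega)]; simp

lemma hasSum_limLaw_mul (hK : IsContractingKernel K r) {f : ℕ →ᵇ ℝ} (hf : ∀ x, 0 ≤ f x) :
    HasSum (fun k => hK.limLaw k * f k) (hK.limMean f) := by
  rw [hasSum_iff_tendsto_nat_of_nonneg fun k => mul_nonneg (hK.limLaw_nonneg k) (hf k)]
  have split : ∀ N, ∑ k ∈ Finset.range N, hK.limLaw k * f k
      = hK.limMean f - hK.limMean (restr {k | N ≤ k} f) := by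
    intro N
    rw [sum_limLaw_mul, eq_sub_iff_add_eq, ← limMean_add]
    congr 1
    ext x
    by_cases h : x < N <;> simp [Set.indicator, h]
  have tail : Tendsto (fun N => hK.limMean (restr {k | N ≤ k} f)) atTop (𝓝 0) := by
    have hb : Tendsto (fun N : ℕ => ‖f‖ * (r / (1 - r)) * (1 / (N : ℝ))) atTop (𝓝 0) := by
      simpa using (tendsto_one_div_atTop_nhds_zero_nat (𝕜 := ℝ)).const_mul (‖f‖ * (r / (1 - r)))
    refine squeeze_zero' (Eventually.of_forall fun N => hK.limMean_nonneg fun x =>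
      Set.indicator_nonneg (fun y _ => hf y) x) ?_ hb
    filter_upwards [eventually_gt_atTop 0] with N hN
    have hN' : (0 : ℝ) < N := by exact_mod_cast hN
    have h := hK.limMean_le_of_drift (V := fun y => (y : ℝ)) (W := fun x => r * (x + 1)) (s := r)
      (B := r) (c := ‖f‖ / N) hK.rate_nonneg hK.rate_lt_one (by positivity)
      hK.hasSum_mean (fun x => by linarith) (f := restr {k | N ≤ k} f) fun x => by
        rw [restr_apply]
        by_cases hx : N ≤ x
        · rw [Set.indicator_of_mem (show x ∈ {k | N ≤ k} from hx)]
          have hx' : (N : ℝ) ≤ x := by exact_mod_cast hx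
          refine ((le_abs_self _).trans (f.norm_coe_le_norm x)).trans ?_
          rw [div_mul_eq_mul_div, le_div_iff₀ hN']
          exact mul_le_mul_of_nonneg_left hx' (norm_nonneg f)
        · rw [Set.indicator_of_notMem (show x ∉ {k | N ≤ k} from hx)]
          positivity
    refine h.trans (le_of_eq (by ring))
  simp only [split]
  simpa using tail.const_sub (hK.limMean f)

theorem existsUnique_stationary (hK : IsContractingKernel K r) :
    ∃! π : ℕ → ℝ, (∀ x, 0 ≤ π x) ∧ HasSum π 1 ∧ ∀ y, HasSum (fun x => π x * K x y) (π y) := by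
  refine ⟨hK.limLaw, ⟨hK.limLaw_nonneg, ?_, fun y => ?_⟩, ?_⟩
  · have h := hK.hasSum_limLaw_mul (f := BoundedContinuousFunction.const ℕ 1) fun x => zero_le_one
    rw [limMean_const_one] at h
    simpa using h
  · have e : ∀ x, hK.op (restr {y} (BoundedContinuousFunction.const ℕ 1)) x = K x y := by
      intro x
      rw [op_apply, tsum_eq_single y]
      · simp
      · intro b hb; simp [hb]
    have h := hK.hasSum_limLaw_mul
      (f := hK.op (restr {y} (BoundedContinuousFunction.const ℕ 1))) fun x => by
        rw [e]; exact hK.nonneg x y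
    simp only [limMean_op, e] at h
    exact h
  · rintro π ⟨h0, h1, hst⟩
    funext k
    have h := hK.hasSum_of_stationary h0 h1 hst (restr {k} (BoundedContinuousFunction.const ℕ 1))
    refine (hasSum_single k ?_).unique (h : HasSum _ (hK.limLaw k)) |>.symm.trans ?_ |>.symm
    · intro b hb; simp [hb]
    · simp

theorem summable_of_drift (hK : IsContractingKernel K r) {V W : ℕ → ℝ} {s B : ℝ} (hs0 : 0 ≤ s)
    (hs1 : s < 1) (hV : ∀ x, 0 ≤ V x)
    (hsum : ∀ x, HasSum (fun y => K x y * V y) (W x)) (hW : ∀ x, W x ≤ s * V x + B)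
    {π : ℕ → ℝ} (h0 : ∀ x, 0 ≤ π x)
    (h1 : HasSum π 1) (hst : ∀ y, HasSum (fun x => π x * K x y) (π y)) :
    Summable fun x => π x * V x := by
  refine summable_of_sum_le (c := B / (1 - s)) (fun x => mul_nonneg (h0 x) (hV x)) fun t => ?_
  let f : ℕ →ᵇ ℝ := BoundedContinuousFunction.ofNormedAddCommGroupDiscrete
    ((t : Set ℕ).indicator V) (∑ x ∈ t, V x) fun x => by
      by_cases hx : x ∈ t
      · rw [Set.indicator_of_mem (Finset.mem_coe.2 hx), Real.norm_of_nonneg (hV x)]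
        exact Finset.single_le_sum (fun i _ => hV i) hx
      · rw [Set.indicator_of_notMem (by simpa using hx), norm_zero]
        exact Finset.sum_nonneg fun i _ => hV i
  have hfa : ∀ x, f x = (t : Set ℕ).indicator V x := fun x => rfl
  have h := hK.limMean_le_of_drift hs0 hs1 zero_le_one hsum hW (f := f) fun x => by
    rw [hfa, one_mul]; exact Set.indicator_le_self' (fun y _ => hV y) x
  have h' := hK.hasSum_of_stationary h0 h1 hst f
  have h'' : ∑ x ∈ t, π x * f x ≤ hK.limMean f := sum_le_hasSum t (fun x _ =>
    mul_nonneg (h0 x) (by rw [hfa]; exact Set.indicator_nonneg (fun y _ => hV y) x)) h'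
  have e : ∑ x ∈ t, π x * f x = ∑ x ∈ t, π x * V x := Finset.sum_congr rfl fun x hx => by
    rw [hfa, Set.indicator_of_mem (Finset.mem_coe.2 hx)]
  rw [one_mul] at h
  linarith

end IsContractingKernel

/-- The weight `a^(x+1) (1-a)^y`. -/
def weight (x y : ℕ) (a : ℝ) : ℝ := a ^ (x + 1) * (1 - a) ^ y

/-- The logarithmic derivative of `weight` in `a`. -/
noncomputable def score (x y : ℕ) (a : ℝ) : ℝ := (x + 1) / a - y / (1 - a)

/-- The derivative of `score` in `a`. -/
noncomputable def scoreDeriv (x y : ℕ) (a : ℝ) : ℝ := -((x + 1) / a ^ 2) - y / (1 - a) ^ 2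

/-- The mixture of weights whose logarithm is `phi` in the two-point model. -/
def mixWeight (x y : ℕ) (θ : Fin 3 → ℝ) : ℝ :=
  θ 0 * weight x y (θ 1) + (1 - θ 0) * weight x y (θ 2)

/-- The open cube of parameters with all coordinates in `(δ, 1 - δ)`. -/
def openCube (δ : ℝ) : Set (Fin 3 → ℝ) := {θ | ∀ i, θ i ∈ Set.Ioo δ (1 - δ)}

lemma isOpen_openCube (δ : ℝ) : IsOpen (openCube δ) := by
  have : openCube δ = ⋂ i : Fin 3, (fun θ : Fin 3 → ℝ => θ i) ⁻¹' Set.Ioo δ (1 - δ) := by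
    ext θ; simp [openCube]
  rw [this]
  exact isOpen_iInter_of_finite fun i => isOpen_Ioo.preimage (continuous_apply i)

lemma openCube_anti {δ ε : ℝ} (h : δ ≤ ε) : openCube ε ⊆ openCube δ := fun θ hθ i =>
  ⟨h.trans_lt (hθ i).1, (hθ i).2.trans_le (by linarith)⟩

lemma mem_Ioo_of_mem_openCube {θ : Fin 3 → ℝ} (hθ : θ ∈ openCube 0) (i : Fin 3) :
    θ i ∈ Set.Ioo (0 : ℝ) 1 := by
  have := hθ i
  rwa [sub_zero] at this

lemma exists_mem_openCube {θ : Fin 3 → ℝ} (hθ : θ ∈ openCube 0) : ∃ δ, 0 < δ ∧ θ ∈ openCube δ := by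
  have h : ∀ i, ∃ δ, 0 < δ ∧ δ < θ i ∧ θ i < 1 - δ := fun i => by
    obtain ⟨h0, h1⟩ := mem_Ioo_of_mem_openCube hθ i
    refine ⟨min (θ i) (1 - θ i) / 2, by have := lt_min h0 (sub_pos.2 h1); linarith, ?_, ?_⟩
    · have := min_le_left (θ i) (1 - θ i); have := lt_min h0 (sub_pos.2 h1); linarith
    · have := min_le_right (θ i) (1 - θ i); have := lt_min h0 (sub_pos.2 h1); linarith
  choose δ h0 h1 h2 using h
  refine ⟨min (δ 0) (min (δ 1) (δ 2)), lt_min (h0 0) (lt_min (h0 1) (h0 2)), ?_⟩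
  have hle : ∀ i, min (δ 0) (min (δ 1) (δ 2)) ≤ δ i := by
    intro i; fin_cases i <;> simp
  intro i
  exact ⟨(hle i).trans_lt (h1 i), (h2 i).trans_le (by linarith [hle i])⟩

lemma twoPointDomain_subset_openCube : twoPointDomain ⊆ openCube 0 := by
  rintro θ ⟨h0, h1, h2, -⟩ i
  rw [sub_zero]
  fin_cases i <;> assumption

lemma weight_pos {a : ℝ} (ha : a ∈ Set.Ioo (0 : ℝ) 1) (x y : ℕ) : 0 < weight x y a := by
  have h1 := ha.1
  have h2 : 0 < 1 - a := by linarith [ha.2]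
  unfold weight
  positivity

lemma mixWeight_pos {θ : Fin 3 → ℝ} (hθ : θ ∈ openCube 0) (x y : ℕ) : 0 < mixWeight x y θ := by
  have h := mem_Ioo_of_mem_openCube hθ
  exact add_pos (mul_pos (h 0).1 (weight_pos (h 1) x y))
    (mul_pos (by linarith [(h 0).2]) (weight_pos (h 2) x y))

lemma natCast_mul_pow_pred {b : ℝ} (hb : b ≠ 0) (y : ℕ) : (y : ℝ) * b ^ (y - 1) = b ^ y * (y / b) := by
  cases y with
  | zero => simp
  | succ y => rw [Nat.add_sub_cancel, pow_succ]; field_simp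

lemma hasDerivAt_weight {a : ℝ} (ha : a ∈ Set.Ioo (0 : ℝ) 1) (x y : ℕ) :
    HasDerivAt (weight x y) (weight x y a * score x y a) a := by
  have ha0 : a ≠ 0 := ha.1.ne'
  have ha1 : 1 - a ≠ 0 := by have := ha.2; exact (by linarith : (0 : ℝ) < 1 - a).ne'
  have h1 := (hasDerivAt_id a).pow (x + 1)
  have h2 := ((hasDerivAt_id a).const_sub 1).pow y
  refine (h1.mul h2).congr_deriv ?_
  simp only [id, weight, score, Nat.add_sub_cancel, Pi.pow_apply]
  rw [natCast_mul_pow_pred ha1 y, pow_succ]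
  push_cast
  field_simp
  ring

lemma hasDerivAt_score {a : ℝ} (ha : a ∈ Set.Ioo (0 : ℝ) 1) (x y : ℕ) :
    HasDerivAt (score x y) (scoreDeriv x y a) a := by
  have ha0 : a ≠ 0 := ha.1.ne'
  have ha1 : 1 - a ≠ 0 := by have := ha.2; exact (by linarith : (0 : ℝ) < 1 - a).ne'
  have h1 := (hasDerivAt_const a ((x : ℝ) + 1)).div (hasDerivAt_id a) ha0
  have h2 := (hasDerivAt_const a (y : ℝ)).div ((hasDerivAt_id a).const_sub 1) ha1
  refine (h1.sub h2).congr_deriv ?_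
  simp only [id, scoreDeriv]
  field_simp
  ring

lemma hasDerivAt_weight_mul_score {a : ℝ} (ha : a ∈ Set.Ioo (0 : ℝ) 1) (x y : ℕ) :
    HasDerivAt (fun a => weight x y a * score x y a)
      (weight x y a * (score x y a ^ 2 + scoreDeriv x y a)) a :=
  ((hasDerivAt_weight ha x y).mul (hasDerivAt_score ha x y)).congr_deriv (by ring)

section Gradient

variable {d : ℕ} {f g : (Fin d → ℝ) → ℝ} {θ : Fin d → ℝ}

lemma grad_congr (h : f =ᶠ[𝓝 θ] g) : grad f θ = grad g θ := by
  unfold grad; rw [h.fderiv_eq]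

lemma grad_const_mul (c : ℝ) (hf : DifferentiableAt ℝ f θ) (i : Fin d) :
    grad (fun θ => c * f θ) θ i = c * grad f θ i := by
  simp [grad, (hf.hasFDerivAt.const_mul c).fderiv]

lemma grad_log (hf : DifferentiableAt ℝ f θ) (h0 : f θ ≠ 0) (i : Fin d) :
    grad (fun θ => Real.log (f θ)) θ i = grad f θ i / f θ := by
  simp [grad, (hf.hasFDerivAt.log h0).fderiv, div_eq_inv_mul]

lemma grad_div (hf : DifferentiableAt ℝ f θ) (hg : DifferentiableAt ℝ g θ) (h0 : g θ ≠ 0)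
    (i : Fin d) :
    grad (fun θ => f θ / g θ) θ i = grad f θ i / g θ - f θ / g θ * (grad g θ i / g θ) := by
  have h := (hf.hasFDerivAt.mul ((hasDerivAt_inv h0).comp_hasFDerivAt θ hg.hasFDerivAt)).fderiv
  have e : (fun θ => f θ / g θ) = f * (Inv.inv ∘ g) := by
    funext θ; simp [div_eq_mul_inv]
  unfold grad
  rw [e, h]
  simp
  field_simp
  ring

end Gradient

lemma hasFDerivAt_affine_mixture {A B v w : ℝ → ℝ} {A' B' v' w' : ℝ} {θ : Fin 3 → ℝ}
    (hA : HasDerivAt A A' (θ 0)) (hB : HasDerivAt B B' (θ 0)) (hv : HasDerivAt v v' (θ 1))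
    (hw : HasDerivAt w w' (θ 2)) :
    DifferentiableAt ℝ (fun θ : Fin 3 → ℝ => A (θ 0) * v (θ 1) + B (θ 0) * w (θ 2)) θ ∧
    grad (fun θ : Fin 3 → ℝ => A (θ 0) * v (θ 1) + B (θ 0) * w (θ 2)) θ
      = ![A' * v (θ 1) + B' * w (θ 2), A (θ 0) * v', B (θ 0) * w'] := by
  have P : ∀ i, HasFDerivAt (fun θ : Fin 3 → ℝ => θ i)
      (ContinuousLinearMap.proj (R := ℝ) (φ := fun _ : Fin 3 => ℝ) i) θ := fun i =>
    hasFDerivAt_apply i θ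
  have h := ((hA.comp_hasFDerivAt θ (P 0)).mul (hv.comp_hasFDerivAt θ (P 1))).add
    ((hB.comp_hasFDerivAt θ (P 0)).mul (hw.comp_hasFDerivAt θ (P 2)))
  refine ⟨h.differentiableAt, ?_⟩
  funext i
  have e : grad (fun θ : Fin 3 → ℝ => A (θ 0) * v (θ 1) + B (θ 0) * w (θ 2)) θ i = _ :=
    congrArg (fun L : (Fin 3 → ℝ) →L[ℝ] ℝ => L (Pi.single i 1)) h.fderiv
  rw [e]
  fin_cases i <;> simp <;> ring

/-- The gradient of `mixWeight`. -/
noncomputable def mixGrad (x y : ℕ) (j : Fin 3) (θ : Fin 3 → ℝ) : ℝ :=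
  (![weight x y (θ 1) - weight x y (θ 2), θ 0 * (weight x y (θ 1) * score x y (θ 1)),
    (1 - θ 0) * (weight x y (θ 2) * score x y (θ 2))] : Fin 3 → ℝ) j

lemma differentiableAt_mixWeight_and_grad {θ : Fin 3 → ℝ} (hθ : θ ∈ openCube 0) (x y : ℕ) :
    DifferentiableAt ℝ (mixWeight x y) θ ∧ ∀ j, grad (mixWeight x y) θ j = mixGrad x y j θ := by
  have hI := mem_Ioo_of_mem_openCube hθ
  obtain ⟨h1, h2⟩ := hasFDerivAt_affine_mixture (θ := θ) (hasDerivAt_id (θ 0))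
    ((hasDerivAt_id (θ 0)).const_sub 1) (hasDerivAt_weight (hI 1) x y)
    (hasDerivAt_weight (hI 2) x y)
  refine ⟨h1, fun j => ?_⟩
  have := congrFun h2 j
  refine this.trans ?_
  fin_cases j <;> simp [mixGrad] <;> ring

lemma differentiableAt_mixGrad_and_grad {θ : Fin 3 → ℝ} (hθ : θ ∈ openCube 0) (x y : ℕ)
    (j : Fin 3) :
    DifferentiableAt ℝ (mixGrad x y j) θ ∧ grad (mixGrad x y j) θ =
      (![![0, weight x y (θ 1) * score x y (θ 1), -(weight x y (θ 2) * score x y (θ 2))],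
        ![weight x y (θ 1) * score x y (θ 1),
          θ 0 * (weight x y (θ 1) * (score x y (θ 1) ^ 2 + scoreDeriv x y (θ 1))), 0],
        ![-(weight x y (θ 2) * score x y (θ 2)), 0,
          (1 - θ 0) * (weight x y (θ 2) * (score x y (θ 2) ^ 2 + scoreDeriv x y (θ 2)))]] :
        Fin 3 → Fin 3 → ℝ) j := by
  have hI := mem_Ioo_of_mem_openCube hθ
  have c := fun b : ℝ => hasDerivAt_const (θ 0) b
  have i := hasDerivAt_id (θ 0)
  have i' := (hasDerivAt_id (θ 0)).const_sub 1
  have w1 := hasDerivAt_weight (hI 1) x y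
  have w2 := hasDerivAt_weight (hI 2) x y
  have s1 := hasDerivAt_weight_mul_score (hI 1) x y
  have s2 := hasDerivAt_weight_mul_score (hI 2) x y
  fin_cases j
  · have e : mixGrad x y 0 = fun θ : Fin 3 → ℝ =>
        (fun _ => (1 : ℝ)) (θ 0) * weight x y (θ 1) + (fun _ => (-1 : ℝ)) (θ 0) * weight x y (θ 2) := by
      funext θ; simp [mixGrad]; ring
    obtain ⟨h1, h2⟩ := hasFDerivAt_affine_mixture (c 1) (c (-1)) w1 w2
    refine ⟨?_, ?_⟩
    · simp only [Fin.zero_eta]; rw [e]; exact h1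
    · simp only [Fin.zero_eta]; rw [e]; rw [h2]; simp
  · have e : mixGrad x y 1 = fun θ : Fin 3 → ℝ =>
        id (θ 0) * (fun a => weight x y a * score x y a) (θ 1)
          + (fun _ => (0 : ℝ)) (θ 0) * weight x y (θ 2) := by
      funext θ; simp [mixGrad]
    obtain ⟨h1, h2⟩ := hasFDerivAt_affine_mixture i (c 0) s1 w2
    refine ⟨?_, ?_⟩
    · simp only [Fin.mk_one]; rw [e]; exact h1
    · simp only [Fin.mk_one]; rw [e]; rw [h2]; simp
  · have e : mixGrad x y 2 = fun θ : Fin 3 → ℝ =>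
        (fun _ => (0 : ℝ)) (θ 0) * weight x y (θ 1)
          + (1 - id (θ 0)) * (fun a => weight x y a * score x y a) (θ 2) := by
      funext θ; simp [mixGrad]
    obtain ⟨h1, h2⟩ := hasFDerivAt_affine_mixture (c 0) i' w1 s2
    refine ⟨?_, ?_⟩
    · simp only [Fin.reduceFinMk]; rw [e]; exact h1
    · simp only [Fin.reduceFinMk]; rw [e]; rw [h2]; simp

section Bounds

variable {δ : ℝ} {θ : Fin 3 → ℝ} {x y : ℕ}

lemma abs_score_le {a : ℝ} (hδ : 0 < δ) (ha : a ∈ Set.Ioo δ (1 - δ)) :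
    |score x y a| ≤ (x + y + 1) / δ := by
  have h1 : ((x : ℝ) + 1) / a ≤ (x + 1) / δ := by gcongr; exact ha.1.le
  have h2 : (y : ℝ) / (1 - a) ≤ y / δ := by gcongr; linarith [ha.2]
  have h3 : 0 ≤ ((x : ℝ) + 1) / a := div_nonneg (by positivity) (hδ.trans ha.1).le
  have h4 : 0 ≤ (y : ℝ) / (1 - a) := div_nonneg (by positivity) (by linarith [ha.2])
  have e : ((x : ℝ) + y + 1) / δ = (x + 1) / δ + y / δ := by ring
  rw [score, abs_le, e]
  constructor <;> linarith

lemma abs_scoreDeriv_le {a : ℝ} (hδ : 0 < δ) (ha : a ∈ Set.Ioo δ (1 - δ)) :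
    |scoreDeriv x y a| ≤ ((x + y + 1) / δ) ^ 2 := by
  have h1 : ((x : ℝ) + 1) / a ^ 2 ≤ (x + 1) / δ ^ 2 := by gcongr; exact ha.1.le
  have h2 : (y : ℝ) / (1 - a) ^ 2 ≤ y / δ ^ 2 := by gcongr; linarith [ha.2]
  have h3 : 0 ≤ ((x : ℝ) + 1) / a ^ 2 := by positivity
  have h4 : 0 ≤ (y : ℝ) / (1 - a) ^ 2 := by positivity
  have e : ((x : ℝ) + y + 1) / δ ^ 2 = (x + 1) / δ ^ 2 + y / δ ^ 2 := by ring
  have h5 : ((x : ℝ) + y + 1) / δ ^ 2 ≤ ((x + y + 1) / δ) ^ 2 := by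
    rw [div_pow]
    gcongr
    have hx : (0 : ℝ) ≤ x := by positivity
    have hy : (0 : ℝ) ≤ y := by positivity
    nlinarith
  rw [scoreDeriv, abs_le]
  constructor <;> linarith

lemma mul_weight_le (hθ : θ ∈ openCube 0) :
    θ 0 * weight x y (θ 1) ≤ mixWeight x y θ ∧ (1 - θ 0) * weight x y (θ 2) ≤ mixWeight x y θ := by
  have hI := mem_Ioo_of_mem_openCube hθ
  have h1 := mul_nonneg (hI 0).1.le (weight_pos (hI 1) x y).le
  have h2 := mul_nonneg (sub_pos.2 (hI 0).2).le (weight_pos (hI 2) x y).le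
  unfold mixWeight
  constructor <;> linarith

lemma weight_le (hδ : 0 < δ) (hθ : θ ∈ openCube δ) :
    weight x y (θ 1) ≤ mixWeight x y θ / δ ∧ weight x y (θ 2) ≤ mixWeight x y θ / δ := by
  have hθ0 := openCube_anti hδ.le hθ
  have hI := mem_Ioo_of_mem_openCube hθ0
  obtain ⟨h1, h2⟩ := mul_weight_le (x := x) (y := y) hθ0
  have p1 := weight_pos (hI 1) x y
  have p2 := weight_pos (hI 2) x y
  have := (hθ 0).1
  have := (hθ 0).2
  rw [le_div_iff₀ hδ, le_div_iff₀ hδ]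
  constructor <;> nlinarith

lemma lt_one_of_mem_openCube (hδ : 0 < δ) (hθ : θ ∈ openCube δ) : δ < 1 := by
  have := (hθ 0).1.trans (hθ 0).2
  linarith

lemma one_le_div (hδ : 0 < δ) (hδ1 : δ < 1) : 1 ≤ ((x : ℝ) + y + 1) / δ := by
  rw [le_div_iff₀ hδ]
  have hx : (0 : ℝ) ≤ x := by positivity
  have hy : (0 : ℝ) ≤ y := by positivity
  linarith

lemma abs_mixGrad_le (hδ : 0 < δ) (hθ : θ ∈ openCube δ) (j : Fin 3) :
    |mixGrad x y j θ| ≤ ((x + y + 1) / δ) * mixWeight x y θ := by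
  have hδ1 := lt_one_of_mem_openCube hδ hθ
  have hθ0 := openCube_anti hδ.le hθ
  have hI := mem_Ioo_of_mem_openCube hθ0
  have hF := mixWeight_pos hθ0 x y
  obtain ⟨h1, h2⟩ := mul_weight_le (x := x) (y := y) hθ0
  obtain ⟨h3, h4⟩ := weight_le (x := x) (y := y) hδ hθ
  have p1 := weight_pos (hI 1) x y
  have p2 := weight_pos (hI 2) x y
  have s1 := abs_score_le (x := x) (y := y) hδ (hθ 1)
  have s2 := abs_score_le (x := x) (y := y) hδ (hθ 2)
  fin_cases j
  · simp only [mixGrad, Fin.zero_eta, Matrix.cons_val_zero]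
    have e : mixWeight x y θ / δ ≤ ((x + y + 1) / δ) * mixWeight x y θ := by
      rw [div_mul_eq_mul_div]
      gcongr
      have hx : (0 : ℝ) ≤ x := by positivity
      have hy : (0 : ℝ) ≤ y := by positivity
      nlinarith
    rw [abs_le]
    constructor <;> linarith
  · simp only [mixGrad, Fin.mk_one, Matrix.cons_val_one, Matrix.cons_val_zero]
    rw [← mul_assoc, abs_mul, abs_of_pos (mul_pos (hI 0).1 p1), mul_comm]
    exact mul_le_mul s1 h1 (mul_pos (hI 0).1 p1).le (by positivity)
  · simp only [mixGrad, Fin.reduceFinMk, Matrix.cons_val]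
    rw [← mul_assoc, abs_mul, abs_of_pos (mul_pos (sub_pos.2 (hI 0).2) p2), mul_comm]
    exact mul_le_mul s2 h2 (mul_pos (sub_pos.2 (hI 0).2) p2).le (by positivity)

lemma abs_grad_mixGrad_le (hδ : 0 < δ) (hθ : θ ∈ openCube δ) (i j : Fin 3) :
    |grad (mixGrad x y j) θ i| ≤ 2 * (((x + y + 1) / δ) ^ 2 / δ) * mixWeight x y θ := by
  have hδ1 := lt_one_of_mem_openCube hδ hθ
  have hθ0 := openCube_anti hδ.le hθ
  have hI := mem_Ioo_of_mem_openCube hθ0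
  have hF := mixWeight_pos hθ0 x y
  obtain ⟨h1, h2⟩ := mul_weight_le (x := x) (y := y) hθ0
  obtain ⟨h3, h4⟩ := weight_le (x := x) (y := y) hδ hθ
  have p1 := weight_pos (hI 1) x y
  have p2 := weight_pos (hI 2) x y
  have q1 := sub_pos.2 (hI 0).2
  have s1 := abs_score_le (x := x) (y := y) hδ (hθ 1)
  have s2 := abs_score_le (x := x) (y := y) hδ (hθ 2)
  have t1 := abs_scoreDeriv_le (x := x) (y := y) hδ (hθ 1)
  have t2 := abs_scoreDeriv_le (x := x) (y := y) hδ (hθ 2)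
  have hn := one_le_div (x := x) (y := y) hδ hδ1
  rw [(differentiableAt_mixGrad_and_grad hθ0 x y j).2]
  set n : ℝ := ((x : ℝ) + y + 1) / δ with hndef
  set F := mixWeight x y θ with hFdef
  have hn2 : n ≤ n ^ 2 := by nlinarith
  have zero : 0 ≤ 2 * (n ^ 2 / δ) * F := by positivity
  have A : ∀ u s : ℝ, 0 < u → u ≤ F / δ → |s| ≤ n → |u * s| ≤ 2 * (n ^ 2 / δ) * F := by
    intro u s hu huF hs
    rw [abs_mul, abs_of_pos hu]
    calc u * |s| ≤ F / δ * n ^ 2 := by gcongr; exact hs.trans hn2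
      _ = n ^ 2 / δ * F := by ring
      _ ≤ 2 * (n ^ 2 / δ) * F := by
        have : 0 ≤ n ^ 2 / δ * F := by positivity
        linarith
  have B : ∀ p u s t : ℝ, 0 < p → 0 < u → p * u ≤ F → |s| ≤ n → |t| ≤ n ^ 2 →
      |p * (u * (s ^ 2 + t))| ≤ 2 * (n ^ 2 / δ) * F := by
    intro p u s t hp hu hpu hs ht
    have hs2 : |s ^ 2 + t| ≤ 2 * n ^ 2 := by
      refine (abs_add_le _ _).trans ?_
      rw [abs_pow]
      have := pow_le_pow_left₀ (abs_nonneg s) hs 2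
      linarith
    rw [← mul_assoc, abs_mul, abs_of_pos (mul_pos hp hu)]
    calc p * u * |s ^ 2 + t| ≤ F * (2 * n ^ 2) := by gcongr
      _ = 2 * (n ^ 2 / 1) * F := by ring
      _ ≤ 2 * (n ^ 2 / δ) * F := by gcongr
  fin_cases j <;> fin_cases i <;> simp only [Fin.zero_eta, Fin.mk_one, Fin.reduceFinMk,
    Matrix.cons_val, Matrix.cons_val_zero, Matrix.cons_val_one, abs_neg, abs_zero]
  · exact zero
  · exact A _ _ p1 h3 s1
  · exact A _ _ p2 h4 s2
  · exact A _ _ p1 h3 s1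
  · exact B _ _ _ _ (hI 0).1 p1 h1 s1 t1
  · exact zero
  · exact A _ _ p2 h4 s2
  · exact zero
  · exact B _ _ _ _ q1 p2 h2 s2 t2

end Bounds

lemma hasSum_of_eq {f g : ℕ → ℝ} {a b : ℝ} (h : HasSum f a) (hf : ∀ y, g y = f y) (hb : b = a) :
    HasSum g b := by
  rwa [funext hf, hb]

section TwoPoint

variable {θ : Fin 3 → ℝ}

lemma integral_twoPoint (hθ : θ ∈ openCube 0) (f : ℝ → ℝ) :
    ∫ a, f a ∂(twoPoint θ) = θ 0 * f (θ 1) + (1 - θ 0) * f (θ 2) := by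
  have h := mem_Ioo_of_mem_openCube hθ 0
  rw [twoPoint, integral_add_measure, integral_smul_measure, integral_smul_measure, integral_dirac,
    integral_dirac, ENNReal.toReal_ofReal h.1.le, ENNReal.toReal_ofReal (sub_pos.2 h.2).le,
    smul_eq_mul, smul_eq_mul]
  · exact (integrable_dirac (by simp)).smul_measure ENNReal.ofReal_ne_top
  · exact (integrable_dirac (by simp)).smul_measure ENNReal.ofReal_ne_top

lemma isProbabilityMeasure_twoPoint (hθ : θ ∈ openCube 0) : IsProbabilityMeasure (twoPoint θ) := by
  have h := mem_Ioo_of_mem_openCube hθ 0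
  constructor
  simp only [twoPoint, Measure.add_apply, Measure.smul_apply, measure_univ, smul_eq_mul, mul_one]
  rw [← ENNReal.ofReal_add h.1.le (sub_pos.2 h.2).le]
  simp

lemma integral_envLaw (hθ : θ ∈ openCube 0) {f : ℝ → ℝ} (hf : Measurable f) :
    ∫ ω, f (ω 0) ∂(envLaw twoPoint θ) = θ 0 * f (θ 1) + (1 - θ 0) * f (θ 2) := by
  have := isProbabilityMeasure_twoPoint hθ
  have hmp := measurePreserving_eval_infinitePi (fun _ : ℤ => twoPoint θ) 0
  rw [← integral_twoPoint hθ, ← hmp.map_eq, integral_map hmp.measurable.aemeasurable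
    hf.aestronglyMeasurable]
  rfl

lemma phi_twoPoint (hθ : θ ∈ openCube 0) (x y : ℕ) :
    phi twoPoint x y θ = Real.log (mixWeight x y θ) := by
  have h := mem_Ioo_of_mem_openCube hθ
  rw [phi, ← integral_indicator measurableSet_Ioo, integral_twoPoint hθ,
    Set.indicator_of_mem (h 1), Set.indicator_of_mem (h 2)]
  rfl

lemma Q_twoPoint (hθ : θ ∈ openCube 0) (x y : ℕ) :
    Q twoPoint x y θ = ((x + y).choose x : ℝ) * mixWeight x y θ := by
  rw [Q, phi_twoPoint hθ, Real.exp_log (mixWeight_pos hθ x y)]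

lemma Q_twoPoint_eq_negBin (hθ : θ ∈ openCube 0) (x y : ℕ) :
    Q twoPoint x y θ = θ 0 * negBin (θ 1) x y + (1 - θ 0) * negBin (θ 2) x y := by
  rw [Q_twoPoint hθ, mixWeight, negBin, negBin, weight, weight]
  ring

lemma hasSum_Q_mul_choose (hθ : θ ∈ openCube 0) (x j : ℕ) :
    HasSum (fun y => Q twoPoint x y θ * (y.choose j : ℝ)) (((x + j).choose j : ℝ) *
      (θ 0 * ((1 - θ 1) / θ 1) ^ j + (1 - θ 0) * ((1 - θ 2) / θ 2) ^ j)) := by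
  have hI := mem_Ioo_of_mem_openCube hθ
  have h := ((hasSum_negBin_mul_choose (hI 1) x j).mul_left (θ 0)).add
    ((hasSum_negBin_mul_choose (hI 2) x j).mul_left (1 - θ 0))
  simp only [Q_twoPoint_eq_negBin hθ]
  exact hasSum_of_eq h (fun y => by ring) (by ring)

lemma hasSum_Q (hθ : θ ∈ openCube 0) (x : ℕ) : HasSum (fun y => Q twoPoint x y θ) 1 := by
  simpa using hasSum_Q_mul_choose hθ x 0

lemma isContractingKernel_Q (hθ : θ ∈ openCube 0)
    (hr : θ 0 * ((1 - θ 1) / θ 1) + (1 - θ 0) * ((1 - θ 2) / θ 2) < 1) :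
    IsContractingKernel (fun x y => Q twoPoint x y θ)
      (θ 0 * ((1 - θ 1) / θ 1) + (1 - θ 0) * ((1 - θ 2) / θ 2)) := by
  have hI := mem_Ioo_of_mem_openCube hθ
  have p0 := (hI 0).1
  have p1 := sub_pos.2 (hI 0).2
  have r1 := (div_pos (sub_pos.2 (hI 1).2) (hI 1).1).le
  have r2 := (div_pos (sub_pos.2 (hI 2).2) (hI 2).1).le
  refine ⟨fun x y => ?_, hasSum_Q hθ, fun x => ?_, by positivity, hr, fun f c hf x => ?_⟩
  · rw [Q]; positivity
  · have h := hasSum_Q_mul_choose hθ x 1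
    simp only [Nat.choose_one_right, pow_one, Nat.cast_add, Nat.cast_one] at h
    rwa [mul_comm] at h
  · have hC : ∀ y, |f y| ≤ ‖f‖ := fun y => f.norm_coe_le_norm y
    have S : ∀ {a : ℝ}, a ∈ Set.Ioo (0 : ℝ) 1 → ∀ x, Summable fun y => negBin a x y * f y :=
      fun ha x => summable_mul_of_bounded (hasSum_negBin ha x).summable (negBin_nonneg ha x) hC
    have e : ∀ x, ∑' y, Q twoPoint x y θ * f y
        = θ 0 * ∑' y, negBin (θ 1) x y * f y + (1 - θ 0) * ∑' y, negBin (θ 2) x y * f y := by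
      intro x
      rw [← tsum_mul_left, ← tsum_mul_left,
        ← ((S (hI 1) x).mul_left _).tsum_add ((S (hI 2) x).mul_left _)]
      exact tsum_congr fun y => by rw [Q_twoPoint_eq_negBin hθ]; ring
    have h1 := abs_le.1 (abs_tsum_negBin_succ_sub_le (hI 1) hC hf x)
    have h2 := abs_le.1 (abs_tsum_negBin_succ_sub_le (hI 2) hC hf x)
    have a1 := mul_le_mul_of_nonneg_left h1.1 p0.le
    have a2 := mul_le_mul_of_nonneg_left h1.2 p0.le
    have b1 := mul_le_mul_of_nonneg_left h2.1 p1.le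
    have b2 := mul_le_mul_of_nonneg_left h2.2 p1.le
    rw [e, e, abs_le]
    constructor <;> linarith

lemma isStationaryLaw_iff {d : ℕ} (ν : Model d) (θ : Fin d → ℝ) (π : ℕ → ℝ) :
    IsStationaryLaw ν θ π ↔
      (∀ x, 0 ≤ π x) ∧ HasSum π 1 ∧ ∀ y, HasSum (fun x => π x * Q ν x y θ) (π y) :=
  ⟨fun h => ⟨h.1, h.2, h.3⟩, fun h => ⟨h.1, h.2.1, h.2.2⟩⟩

lemma cast_choose_three (n : ℕ) : (n.choose 3 : ℝ) = n * (n - 1) * (n - 2) / 6 := by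
  induction n with
  | zero => simp
  | succ n ih =>
    rw [Nat.choose_succ_succ' n 2, Nat.cast_add, ih, Nat.cast_choose_two]
    push_cast; ring

lemma exists_drift {r : ℝ} (hr0 : 0 ≤ r) (hr : r < 1) : ∃ s B : ℝ, 0 ≤ s ∧ s < 1 ∧
    ∀ x : ℕ, ((x + 3).choose 3 : ℝ) * r ≤ s * (x.choose 3 : ℝ) + B := by
  have h1 : 0 < 1 - r := by linarith
  refine ⟨(1 + r) / 2, 3 * (36 / (1 - r)) ^ 2 + 1, by linarith, by linarith, fun x => ?_⟩
  set e := 1 - r with he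
  have hre : r = 1 - e := by rw [he]; ring
  rw [cast_choose_three, cast_choose_three, hre]
  push_cast
  have hx : (0 : ℝ) ≤ x := by positivity
  have hx2 : (x : ℝ) ≤ (x : ℝ) ^ 2 := by exact_mod_cast Nat.le_self_pow two_ne_zero x
  generalize (x : ℝ) = t at hx hx2 ⊢
  have key : 36 * t ^ 2 ≤ e * t ^ 3 + 36 * (36 / e) ^ 2 := by
    rcases le_total (36 / e) t with h | h
    · have h2 : 36 ≤ t * e := by rwa [div_le_iff₀ h1] at h
      have h3 : 36 * t ^ 2 ≤ t * e * t ^ 2 := by gcongr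
      have h4 : (0 : ℝ) ≤ (36 / e) ^ 2 := by positivity
      linarith
    · have h2 : t ^ 2 ≤ (36 / e) ^ 2 := by gcongr
      have h6 : 0 ≤ e * t ^ 3 := by positivity
      linarith
  have h7 : 0 ≤ e * t ^ 2 := by positivity
  have h8 : 0 ≤ e * t := by positivity
  linarith

lemma cube_le_choose_three (n : ℕ) : (n : ℝ) ^ 3 ≤ 16 * (n.choose 3 : ℝ) + 27 := by
  rcases le_or_gt n 3 with h | h
  · interval_cases n <;> norm_num [Nat.choose]
  · rw [cast_choose_three]
    have hn : (4 : ℝ) ≤ n := by exact_mod_cast h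
    generalize (n : ℝ) = t at hn ⊢
    nlinarith [mul_nonneg (by linarith : (0 : ℝ) ≤ t) (mul_nonneg (sub_nonneg.2 hn) (sub_nonneg.2 hn)),
      mul_nonneg (by linarith : (0 : ℝ) ≤ t) (sub_nonneg.2 hn)]

lemma cube_add_add_one_le (x y : ℕ) : ((x : ℝ) + y + 1) ^ 3 ≤
    9 * (16 * (x.choose 3 : ℝ) + 16 * (y.choose 3 : ℝ) + 55) := by
  have h1 := cube_le_choose_three x
  have h2 := cube_le_choose_three y
  have hx : (0 : ℝ) ≤ x := by positivity
  have hy : (0 : ℝ) ≤ y := by positivity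
  have h : ((x : ℝ) + y + 1) ^ 3 ≤ 9 * ((x : ℝ) ^ 3 + (y : ℝ) ^ 3 + 1) := by
    generalize (x : ℝ) = a at hx ⊢
    generalize (y : ℝ) = b at hy ⊢
    nlinarith [mul_nonneg (add_nonneg hx hy) (sq_nonneg (a - b)),
      mul_nonneg (add_nonneg hx zero_le_one) (sq_nonneg (a - 1)),
      mul_nonneg (add_nonneg hy zero_le_one) (sq_nonneg (b - 1)),
      mul_nonneg hx (sq_nonneg (b - 1)), mul_nonneg hy (sq_nonneg (a - 1)), sq_nonneg (a - b)]
  linarith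

/-- Third moments of a stationary pair in the two-point model. -/
lemma summable_stationary_pair (hθ : θ ∈ openCube 0)
    (h1 : θ 0 * ((1 - θ 1) / θ 1) + (1 - θ 0) * ((1 - θ 2) / θ 2) < 1)
    (h3 : θ 0 * ((1 - θ 1) / θ 1) ^ 3 + (1 - θ 0) * ((1 - θ 2) / θ 2) ^ 3 < 1)
    {π : ℕ → ℝ} (hπ : IsStationaryLaw twoPoint θ π) :
    Summable fun z : ℕ × ℕ => π z.1 * Q twoPoint z.1 z.2 θ * ((z.1 : ℝ) + z.2 + 1) ^ 3 := by
  have hI := mem_Ioo_of_mem_openCube hθ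
  have hK := isContractingKernel_Q hθ h1
  have r0 : 0 ≤ θ 0 * ((1 - θ 1) / θ 1) ^ 3 + (1 - θ 0) * ((1 - θ 2) / θ 2) ^ 3 := by
    have p0 := (hI 0).1
    have p1 := sub_pos.2 (hI 0).2
    have r1 := (div_pos (sub_pos.2 (hI 1).2) (hI 1).1).le
    have r2 := (div_pos (sub_pos.2 (hI 2).2) (hI 2).1).le
    positivity
  obtain ⟨s, B, hs0, hs1, hd⟩ := exists_drift r0 h3
  have hV : Summable fun x => π x * (x.choose 3 : ℝ) :=
    hK.summable_of_drift hs0 hs1 (fun x => by positivity) (fun x => hasSum_Q_mul_choose hθ x 3) hd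
      hπ.nonneg hπ.sum_eq_one hπ.stationary
  have hQ0 : ∀ x y, 0 ≤ Q twoPoint x y θ := hK.nonneg
  have S0 := hK.summable_prod hπ.nonneg hπ.sum_eq_one.summable
  have S1 := hK.summable_prod (p := fun x => π x * (x.choose 3 : ℝ))
    (fun x => mul_nonneg (hπ.nonneg x) (by positivity)) hV
  have S2 : Summable fun z : ℕ × ℕ => π z.2 * Q twoPoint z.2 z.1 θ * (z.1.choose 3 : ℝ) := by
    have hp : 0 ≤ fun z : ℕ × ℕ => π z.2 * Q twoPoint z.2 z.1 θ * (z.1.choose 3 : ℝ) := fun z =>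
      mul_nonneg (mul_nonneg (hπ.nonneg _) (hQ0 _ _)) (by positivity)
    rw [summable_prod_of_nonneg hp]
    constructor
    · intro y
      exact (hπ.stationary y).summable.mul_right (y.choose 3 : ℝ)
    · have e : (fun y => ∑' x, π x * Q twoPoint x y θ * (y.choose 3 : ℝ))
          = fun y => π y * (y.choose 3 : ℝ) := by
        funext y
        rw [tsum_mul_right, (hπ.stationary y).tsum_eq]
      simpa only [e] using hV
  have S2' := (Equiv.prodComm ℕ ℕ).summable_iff.2 S2
  refine Summable.of_nonneg_of_le (fun z => mul_nonneg (mul_nonneg (hπ.nonneg _) (hQ0 _ _))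
    (by positivity)) (fun z => ?_) ((((S1.mul_left 16).add (S2'.mul_left 16)).add
      (S0.mul_left 55)).mul_left 9)
  refine (mul_le_mul_of_nonneg_left (cube_add_add_one_le z.1 z.2)
    (mul_nonneg (hπ.nonneg _) (hQ0 _ _))).trans (le_of_eq ?_)
  simp only [Function.comp, Equiv.prodComm_apply, Prod.fst_swap, Prod.snd_swap]
  ring

lemma piTilde_lt_top {π : ℕ → ℝ} {C : ℝ} (hC : 0 ≤ C) {g : ℕ → ℕ → ℝ≥0∞}
    (h0 : ∀ x y, 0 ≤ π x * Q twoPoint x y θ)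
    (hs : Summable fun z : ℕ × ℕ => π z.1 * Q twoPoint z.1 z.2 θ * ((z.1 : ℝ) + z.2 + 1) ^ 3)
    (hg : ∀ x y : ℕ, g x y ≤ ENNReal.ofReal (C * ((x : ℝ) + y + 1) ^ 3)) :
    piTilde twoPoint θ π g < ∞ := by
  have h : piTilde twoPoint θ π g ≤ ∑' z : ℕ × ℕ,
      ENNReal.ofReal (C * (π z.1 * Q twoPoint z.1 z.2 θ * ((z.1 : ℝ) + z.2 + 1) ^ 3)) := by
    refine ENNReal.tsum_le_tsum fun z => ?_
    refine (mul_le_mul_right (hg z.1 z.2) _).trans (le_of_eq ?_)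
    rw [← ENNReal.ofReal_mul (h0 _ _)]
    congr 1; ring
  refine h.trans_lt ?_
  rw [← ENNReal.ofReal_tsum_of_nonneg (fun z => mul_nonneg hC (mul_nonneg (h0 _ _) (by positivity)))
    (hs.mul_left C)]
  exact ENNReal.ofReal_lt_top

lemma eventually_openCube (hθ : θ ∈ openCube 0) : ∀ᶠ θ' in 𝓝 θ, θ' ∈ openCube 0 :=
  (isOpen_openCube 0).mem_nhds hθ

lemma grad_phi (hθ : θ ∈ openCube 0) (x y : ℕ) (j : Fin 3) :
    grad (phi twoPoint x y) θ j = mixGrad x y j θ / mixWeight x y θ := by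
  have h : phi twoPoint x y =ᶠ[𝓝 θ] fun θ => Real.log (mixWeight x y θ) := by
    filter_upwards [eventually_openCube hθ] with θ' h' using phi_twoPoint h' x y
  have hd := differentiableAt_mixWeight_and_grad hθ x y
  rw [grad_congr h, grad_log hd.1 (mixWeight_pos hθ x y).ne', hd.2]

lemma hess_phi (hθ : θ ∈ openCube 0) (x y : ℕ) (i j : Fin 3) :
    hess (phi twoPoint x y) θ i j = grad (mixGrad x y j) θ i / mixWeight x y θ
      - mixGrad x y j θ / mixWeight x y θ * (mixGrad x y i θ / mixWeight x y θ) := by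
  have h : (fun θ' => grad (phi twoPoint x y) θ' j)
      =ᶠ[𝓝 θ] fun θ => mixGrad x y j θ / mixWeight x y θ := by
    filter_upwards [eventually_openCube hθ] with θ' h' using grad_phi h' x y j
  have hd := differentiableAt_mixWeight_and_grad hθ x y
  rw [hess, grad_congr h, grad_div (differentiableAt_mixGrad_and_grad hθ x y j).1 hd.1
    (mixWeight_pos hθ x y).ne', hd.2]

lemma abs_mixGrad_div_le {δ : ℝ} (hδ : 0 < δ) (hθ : θ ∈ openCube δ) (x y : ℕ) (j : Fin 3) :
    |mixGrad x y j θ / mixWeight x y θ| ≤ (x + y + 1) / δ := by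
  have hF := mixWeight_pos (openCube_anti hδ.le hθ) x y
  rw [abs_div, abs_of_pos hF, div_le_iff₀ hF]
  exact abs_mixGrad_le hδ hθ j

lemma norm_grad_phi_le {δ : ℝ} (hδ : 0 < δ) (hθ : θ ∈ openCube δ) (x y : ℕ) :
    ‖grad (phi twoPoint x y) θ‖ ≤ (x + y + 1) / δ := by
  rw [pi_norm_le_iff_of_nonneg (by positivity)]
  intro j
  rw [grad_phi (openCube_anti hδ.le hθ)]
  exact abs_mixGrad_div_le hδ hθ x y j

lemma norm_hess_phi_le {δ : ℝ} (hδ : 0 < δ) (hθ : θ ∈ openCube δ) (x y : ℕ) :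
    ‖hess (phi twoPoint x y) θ‖ ≤ 2 * (((x + y + 1) / δ) ^ 2 / δ) + ((x + y + 1) / δ) ^ 2 := by
  have hF := mixWeight_pos (openCube_anti hδ.le hθ) x y
  rw [pi_norm_le_iff_of_nonneg (by positivity)]
  intro i
  rw [pi_norm_le_iff_of_nonneg (by positivity)]
  intro j
  rw [hess_phi (openCube_anti hδ.le hθ)]
  refine (norm_sub_le _ _).trans (add_le_add ?_ ?_)
  · rw [Real.norm_eq_abs, abs_div, abs_of_pos hF, div_le_iff₀ hF]
    exact abs_grad_mixGrad_le hδ hθ i j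
  · rw [norm_mul, sq]
    exact mul_le_mul (abs_mixGrad_div_le hδ hθ x y j) (abs_mixGrad_div_le hδ hθ x y i)
      (norm_nonneg _) (by positivity)

lemma contDiffOn_phi (x y : ℕ) : ContDiffOn ℝ 2 (phi twoPoint x y) (openCube 0) := by
  have h : ContDiff ℝ 2 (mixWeight x y) := by
    unfold mixWeight weight
    fun_prop
  exact (h.contDiffOn.log fun θ hθ => (mixWeight_pos hθ x y).ne').congr
    fun θ hθ => phi_twoPoint hθ x y

lemma differentiableAt_Q_and_grad (hθ : θ ∈ openCube 0) (x y : ℕ) :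
    DifferentiableAt ℝ (Q twoPoint x y) θ ∧
      ∀ j, grad (Q twoPoint x y) θ j = ((x + y).choose x : ℝ) * mixGrad x y j θ := by
  have h : Q twoPoint x y =ᶠ[𝓝 θ] fun θ => ((x + y).choose x : ℝ) * mixWeight x y θ := by
    filter_upwards [eventually_openCube hθ] with θ' h' using Q_twoPoint h' x y
  have hd := differentiableAt_mixWeight_and_grad hθ x y
  refine ⟨h.differentiableAt_iff.2 (hd.1.const_mul _), fun j => ?_⟩
  rw [grad_congr h, grad_const_mul _ hd.1, hd.2]

lemma hasSum_negBin_mul_score {a : ℝ} (ha : a ∈ Set.Ioo (0 : ℝ) 1) (x : ℕ) :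
    HasSum (fun y => negBin a x y * score x y a) 0 := by
  have ha0 : a ≠ 0 := ha.1.ne'
  have ha1 : 1 - a ≠ 0 := (sub_pos.2 ha.2).ne'
  have h := ((hasSum_negBin ha x).mul_right (((x : ℝ) + 1) / a)).sub
    ((hasSum_negBin_mul ha x).mul_right (1 / (1 - a)))
  exact hasSum_of_eq h (fun y => by rw [score]; ring) (by field_simp; ring)

lemma hasSum_grad_Q (hθ : θ ∈ openCube 0) (x : ℕ) :
    HasSum (fun y => grad (Q twoPoint x y) θ) 0 := by
  have hI := mem_Ioo_of_mem_openCube hθ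
  rw [Pi.hasSum]
  intro j
  simp only [(differentiableAt_Q_and_grad hθ x _).2, Pi.zero_apply]
  fin_cases j
  · have h := (hasSum_negBin (hI 1) x).sub (hasSum_negBin (hI 2) x)
    rw [sub_self] at h
    exact hasSum_of_eq h (fun y => by simp [mixGrad, negBin, weight]; ring) rfl
  · have h := (hasSum_negBin_mul_score (hI 1) x).mul_left (θ 0)
    rw [mul_zero] at h
    exact hasSum_of_eq h (fun y => by simp [mixGrad, negBin, weight]; ring) rfl
  · have h := (hasSum_negBin_mul_score (hI 2) x).mul_left (1 - θ 0)
    rw [mul_zero] at h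
    exact hasSum_of_eq h (fun y => by simp [mixGrad, negBin, weight]; ring) rfl

lemma measurable_ratio : Measurable fun a : ℝ => (1 - a) / a := by fun_prop

end TwoPoint

end RWRE

theorem proposition7 (Θ : Set (Fin 3 → ℝ)) (hcompact : IsCompact Θ)
    (hdom : Θ ⊆ RWRE.twoPointDomain)
    (htrans : RWRE.TransientRight RWRE.twoPoint Θ)
    (hball : RWRE.Ballistic RWRE.twoPoint Θ)
    (hmoment : ∀ θ ∈ Θ, ∫ ω, (RWRE.rho 0 ω) ^ 3 ∂(RWRE.envLaw RWRE.twoPoint θ) < 1) :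
    (∀ θ ∈ Θ, ∃! π : ℕ → ℝ, RWRE.IsStationaryLaw RWRE.twoPoint θ π) ∧
      RWRE.Differentiability RWRE.twoPoint Θ ∧
      RWRE.Regularity RWRE.twoPoint Θ ∧
      RWRE.UniformConditions RWRE.twoPoint Θ := by
  have hcube : ∀ θ ∈ Θ, θ ∈ RWRE.openCube 0 := fun θ hθ =>
    RWRE.twoPointDomain_subset_openCube (hdom hθ)
  have h1 : ∀ θ ∈ Θ, θ 0 * ((1 - θ 1) / θ 1) + (1 - θ 0) * ((1 - θ 2) / θ 2) < 1 := fun θ hθ => by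
    rw [← RWRE.integral_envLaw (hcube θ hθ) RWRE.measurable_ratio]
    exact (hball θ hθ).2
  have h3 : ∀ θ ∈ Θ, θ 0 * ((1 - θ 1) / θ 1) ^ 3 + (1 - θ 0) * ((1 - θ 2) / θ 2) ^ 3 < 1 :=
    fun θ hθ => by
      rw [← RWRE.integral_envLaw (hcube θ hθ) (RWRE.measurable_ratio.pow_const 3)]
      exact hmoment θ hθ
  have hnn : ∀ θ : Fin 3 → ℝ, ∀ π : ℕ → ℝ, RWRE.IsStationaryLaw RWRE.twoPoint θ π →
      ∀ x y, 0 ≤ π x * RWRE.Q RWRE.twoPoint x y θ := fun θ π hπ x y =>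
    mul_nonneg (hπ.nonneg x) (by rw [RWRE.Q]; positivity)
  refine ⟨fun θ hθ => ?_, fun x y θ hθ => ?_, ⟨fun θ hθ π hπ => ?_, fun θ hθ x => ?_⟩,
    fun θ hθ π hπ => ?_⟩
  · simp only [RWRE.isStationaryLaw_iff]
    exact (RWRE.isContractingKernel_Q (hcube θ hθ) (h1 θ hθ)).existsUnique_stationary
  · exact (RWRE.contDiffOn_phi x y).contDiffAt ((RWRE.isOpen_openCube 0).mem_nhds (hcube θ hθ))
  · obtain ⟨δ, hδ, hθδ⟩ := RWRE.exists_mem_openCube (hcube θ hθ)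
    refine ⟨3 / 2, by norm_num, ?_⟩
    refine RWRE.piTilde_lt_top (C := (1 / δ) ^ 3) (by positivity) (hnn θ π hπ)
      (RWRE.summable_stationary_pair (hcube θ hθ) (h1 θ hθ) (h3 θ hθ) hπ) fun x y => ?_
    have e : (2 * (3 / 2) : ℝ) = (3 : ℕ) := by norm_num
    rw [e, ENNReal.rpow_natCast, ← ofReal_norm, ← ENNReal.ofReal_pow (norm_nonneg _)]
    refine ENNReal.ofReal_le_ofReal ((pow_le_pow_left₀ (norm_nonneg _)
      (RWRE.norm_grad_phi_le hδ hθδ x y) 3).trans (le_of_eq (by ring)))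
  · have hev := RWRE.eventually_openCube (hcube θ hθ)
    have hone : (fun θ' => ∑' y, RWRE.Q RWRE.twoPoint x y θ') =ᶠ[𝓝 θ] fun _ => (1 : ℝ) := by
      filter_upwards [hev] with θ' h' using (RWRE.hasSum_Q h' x).tsum_eq
    refine ⟨fun y => (RWRE.differentiableAt_Q_and_grad (hcube θ hθ) x y).1,
      RWRE.hasSum_grad_Q (hcube θ hθ) x, ?_, ?_, ?_⟩
    · filter_upwards [hev] with θ' h' using (RWRE.hasSum_Q h' x).summable
    · exact hone.differentiableAt_iff.2 (differentiableAt_const _)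
    · rw [RWRE.grad_congr hone]
      funext i
      simp [RWRE.grad]
  · obtain ⟨δ, hδ, hθδ⟩ := RWRE.exists_mem_openCube (hcube θ hθ)
    have hs := RWRE.summable_stationary_pair (hcube θ hθ) (h1 θ hθ) (h3 θ hθ) hπ
    have hpow : ∀ x y : ℕ, ((x : ℝ) + y + 1) ^ 2 ≤ ((x : ℝ) + y + 1) ^ 3 := fun x y =>
      pow_le_pow_right₀ (by linarith [(Nat.cast_nonneg x : (0 : ℝ) ≤ x),
        (Nat.cast_nonneg y : (0 : ℝ) ≤ y)]) (by norm_num)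
    refine ⟨RWRE.openCube δ, RWRE.isOpen_openCube δ, hθδ,
      fun x y => (RWRE.contDiffOn_phi x y).mono (RWRE.openCube_anti hδ.le), ?_, ?_⟩
    · refine RWRE.piTilde_lt_top (C := (1 / δ) ^ 2) (by positivity) (hnn θ π hπ) hs fun x y =>
        iSup₂_le fun θ' hθ' => ?_
      rw [← ofReal_norm, ← ENNReal.ofReal_pow (norm_nonneg _)]
      refine ENNReal.ofReal_le_ofReal ((pow_le_pow_left₀ (norm_nonneg _)
        (RWRE.norm_grad_phi_le hδ hθ' x y) 2).trans ?_)
      rw [div_eq_mul_one_div, mul_pow, mul_comm]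
      exact mul_le_mul_of_nonneg_left (hpow x y) (by positivity)
    · refine RWRE.piTilde_lt_top (C := 2 * ((1 / δ) ^ 2 / δ) + (1 / δ) ^ 2) (by positivity)
        (hnn θ π hπ) hs fun x y => iSup₂_le fun θ' hθ' => ?_
      rw [← ofReal_norm]
      refine ENNReal.ofReal_le_ofReal ((RWRE.norm_hess_phi_le hδ hθ' x y).trans ?_)
      refine le_trans (le_of_eq ?_) (mul_le_mul_of_nonneg_left (hpow x y) (by positivity))
      ring
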